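/- A \emph{continuous signature} is a topological space $E$ partitioned into clopen (possibly empty) subsets $E_n$, $n\in\{0,1,2,\dots\}$. An \emph{$E$-algebra} is a set $X$ together with maps $\Psi_n^X\colon E_n\times X^n\to X$ for all $n\ge 0$. A map $h\colon X\to Y$ of $E$-algebras is a \emph{homomorphism} if $h(\Psi_n^X(t,x_1,\dots,x_n))=\Psi_n^Y(t,h(x_1),\dots,h(x_n))$ for all $n\ge 0$, $t\in E_n$ and $x_1,\dots,x_n\in X$. An $E$-algebra $X$ with a topology is a \emph{semitopological $E$-algebra} if every $\Psi_n^X$ is separately continuous, that is, continuous in $t\in E_n$ and in each $x_i\in X$ when all the other variables are fixed. A topological space $X$ has \emph{caliber $\omega_1$} if every uncountable family of nonempty open subsets of $X$ has an uncountable subfamily with nonempty intersection. \textbf{Theorem.} Let $E$ be a continuous signature and let $X$ be a semitopological $E$-algebra. If $X$ is a compact Hausdorff space with caliber $\omega_1$ and $E$ is separable, then $X$ is $\mathbb R$-factorizable: for every continuous function $f\colon X\to\mathbb R$ there exist a separable metrizable semitopological $E$-algebra $Y$, a continuous homomorphism $h\colon X\to Y$ and a continuous function $g\colon Y\to\mathbb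 R$ such that $f=g\circ h$. -/

import Mathlib

universe u v w

/-- A continuous signature: a topological space `E` of operation symbols, with an arity function
all of whose fibres `E_n` are clopen. -/
class ContinuousSignature (E : Type u) [TopologicalSpace E] where
  /-- The arity of a symbol. -/
  arity : E → ℕ
  isClopen_fiber : ∀ n : ℕ, IsClopen {t : E | arity t = n}

/-- The subspace `E_n` of the `n`-ary symbols of a signature `E`. -/
abbrev ContinuousSignature.Symbols (E : Type u) [TopologicalSpace E] [ContinuousSignature E]
    (n : ℕ) : Type u :=
  {t : E // ContinuousSignature.arity t = n}

/-- The structure of an `E`-algebra on `X`: maps `E_n × X ^ n → X` for all `n`. -/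
class SigAlgebra (E : Type u) [TopologicalSpace E] [ContinuousSignature E] (X : Type v) where
  /-- The map `E_n × X ^ n → X`. -/
  op : ∀ n : ℕ, ContinuousSignature.Symbols E n → (Fin n → X) → X

/-- Separate continuity of a map `T × X ^ n → Z`: it is continuous in the variable from `T`, and in
each of the `n` variables from `X`, whenever all the other variables are fixed. -/
def SeparatelyContinuous {T : Type u} {X : Type v} {Z : Type w} [TopologicalSpace T]
    [TopologicalSpace X] [TopologicalSpace Z] {n : ℕ} (φ : T → (Fin n → X) → Z) : Prop :=
  (∀ x : Fin n → X, Continuous fun t : T => φ t x) ∧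
    ∀ (t : T) (x : Fin n → X) (i : Fin n), Continuous fun y : X => φ t (Function.update x i y)

/-- `X` is a semitopological `E`-algebra: all the maps `E_n × X ^ n → X` are separately
continuous. -/
def IsSemitopologicalAlgebra (E : Type u) [TopologicalSpace E] [ContinuousSignature E]
    (X : Type v) [TopologicalSpace X] [SigAlgebra E X] : Prop :=
  ∀ n : ℕ, SeparatelyContinuous (SigAlgebra.op (E := E) (X := X) n)

/-- `h` is a homomorphism of `E`-algebras. -/
def IsAlgebraHom (E : Type u) [TopologicalSpace E] [ContinuousSignature E] {X : Type v}
    {Y : Type w} [SigAlgebra E X] [SigAlgebra E Y] (h : X → Y) : Prop :=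
  ∀ (n : ℕ) (t : ContinuousSignature.Symbols E n) (x : Fin n → X),
    h (SigAlgebra.op n t x) = SigAlgebra.op n t (fun i => h (x i))

/-- `X` has caliber `ω₁`: every uncountable family of nonempty open sets has an uncountable
subfamily with nonempty intersection. -/
def HasCaliberOmegaOne (X : Type v) [TopologicalSpace X] : Prop :=
  ∀ 𝒰 : Set (Set X), (∀ U ∈ 𝒰, IsOpen U ∧ U.Nonempty) → ¬ 𝒰.Countable →
    ∃ 𝒱 ⊆ 𝒰, ¬ 𝒱.Countable ∧ (⋂₀ 𝒱).Nonempty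

/-- `ℝ`-factorizability of `X` as a semitopological `E`-algebra: every continuous real function on
`X` factors through a continuous homomorphism to a separable metrizable semitopological
`E`-algebra. -/
def IsRFactorizable (E : Type u) [TopologicalSpace E] [ContinuousSignature E]
    (X : Type v) [TopologicalSpace X] [SigAlgebra E X] : Prop :=
  ∀ f : X → ℝ, Continuous f →
    ∃ (Y : Type v) (_ : TopologicalSpace Y) (_ : SigAlgebra E Y) (g : Y → ℝ) (h : X → Y),
      TopologicalSpace.SeparableSpace Y ∧ TopologicalSpace.MetrizableSpace Y ∧
      IsSemitopologicalAlgebra E Y ∧ Continuous g ∧ Continuous h ∧ IsAlgebraHom E h ∧ f = g ∘ h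

open Set Function Filter Topology TopologicalSpace
open scoped Cardinal

/-!
A separately continuous function `F : Xⁿ → ℝ` is determined by countably many of its one-variable
slices. By induction on `n` this reduces to the claim that two values `x`, `y` of one variable that
give the same function of the remaining variables on a suitable countable set give the same function
everywhere. If no countable set works for this, closing off countable sets in the manner of
elementary submodels yields an increasing chain of length `ω₁` and, at each stage, a pair `x`, `y`
that agrees on that stage but not everywhere. The points of disagreement form, variable by variable,
an open set, so caliber `ω₁` provides a single point `z` of disagreement for uncountably many pairs.
On the other hand, limits of the pairs along the chain agree on the union of the chain and hence,
by compactness and the closing off, everywhere, so that the distance between the two values at `z`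
tends to `0` along `ω₁` and therefore vanishes at all but countably many stages.

Starting from `f`, add for each function `q` already present and each operation symbol `t` in a
countable dense set the countably many slices that determine `q ∘ Ψ(t, ·)`. The resulting countable
family of functions has a congruence as its kernel, by density also for the remaining `t`, and the
quotient of `X` by it embeds in a countable product of metrizable spaces.
-/

section SeparateContinuity

variable {ι : Type*} [DecidableEq ι] {X : Type v} {Z : Type w}

/-- Continuity of a function on a power of `X` in each variable, the others being fixed. Unlike
`SeparatelyContinuous`, there is no parameter and the index set of the variables is arbitrary. -/
def ContinuousInEach [TopologicalSpace X] [TopologicalSpace Z] (F : (ι → X) → Z) : Prop :=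
  ∀ (x : ι → X) (i : ι), Continuous fun y => F (update x i y)

/-- The function of one variable obtained from `F` by fixing all variables but the `i`-th. -/
def ContinuousInEach.slice [TopologicalSpace X] [TopologicalSpace Z] {F : (ι → X) → Z}
    (hF : ContinuousInEach F) (x : ι → X) (i : ι) : C(X, Z) :=
  ⟨fun y => F (update x i y), hF x i⟩

theorem eq_of_forall_update_eq [Finite ι] {F : (ι → X) → Z} {x y : ι → X}
    (h : ∀ i c, F (update c i (x i)) = F (update c i (y i))) : F x = F y := by
  cases nonempty_fintype ι
  suffices ∀ s : Finset ι, F (s.piecewise x y) = F y by simpa using this Finset.univ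
  intro s
  induction s using Finset.induction_on with
  | empty => simp
  | insert i s hi ih =>
    rw [Finset.piecewise_insert, h, ← Finset.piecewise_eq_of_notMem s x y hi, update_eq_self, ih]

theorem ContinuousInEach.eqOn_pi_closure [Finite ι] [TopologicalSpace X] [TopologicalSpace Z]
    [T2Space Z] {F G : (ι → X) → Z} (hF : ContinuousInEach F) (hG : ContinuousInEach G)
    {C : ι → Set X} (h : EqOn F G (univ.pi C)) : EqOn F G (univ.pi fun i => closure (C i)) := by
  cases nonempty_fintype ι
  intro r hr
  have hpiecewise : ∀ s : Finset ι, ∀ c ∈ univ.pi C, F (s.piecewise r c) = G (s.piecewise r c) := by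
    intro s
    induction s using Finset.induction_on with
    | empty => simpa using fun c hc => h hc
    | insert i s hi ih =>
      intro c hc
      have hsub : C i ⊆ {y | F (update (s.piecewise r c) i y) = G (update (s.piecewise r c) i y)} :=
        fun y hy => by
          rw [mem_ofPred_eq, Finset.update_piecewise_of_notMem _ _ _ hi]
          exact ih _ ((update_mem_pi_iff_of_mem hc).2 fun _ => hy)
      rw [Finset.piecewise_insert]
      exact closure_minimal hsub (isClosed_eq (hF _ i) (hG _ i)) (hr i (mem_univ i))
  choose c hc using fun i => closure_nonempty_iff.1 ⟨r i, hr i (mem_univ i)⟩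
  simpa using hpiecewise Finset.univ c fun i _ => hc i

/-- `C` determines `F` if two values of any one variable of `F` that give the same function of the
remaining variables on `C` give the same function everywhere. The `i`-th coordinate of `c` is a
dummy. -/
def Determines (F : (ι → X) → Z) (C : Set X) : Prop :=
  ∀ (i : ι) (x y : X),
    EqOn (fun c => F (update c i x)) (fun c => F (update c i y)) (univ.pi fun _ => C) →
      ∀ c, F (update c i x) = F (update c i y)

theorem Determines.mono {F : (ι → X) → Z} {C C' : Set X} (h : Determines F C) (hC : C ⊆ C') :
    Determines F C' :=
  fun i x y hxy => h i x y (hxy.mono (pi_mono fun _ _ => hC))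

end SeparateContinuity

section Caliber

variable {X : Type v} [TopologicalSpace X]

theorem HasCaliberOmegaOne.exists_not_countable (hcal : HasCaliberOmegaOne X) {I : Type*}
    {S : Set I} (hS : ¬ S.Countable) {U : I → Set X} (hU : ∀ a ∈ S, IsOpen (U a))
    (hne : ∀ a ∈ S, (U a).Nonempty) : ∃ x, ¬ {a ∈ S | x ∈ U a}.Countable := by
  by_cases hUS : (U '' S).Countable
  · obtain ⟨_, ⟨a, ha, rfl⟩, hfiber⟩ : ∃ V ∈ U '' S, ¬ {b ∈ S | U b = V}.Countable := by
      by_contra! hfiber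
      refine hS ((hUS.biUnion hfiber).mono fun a ha => ?_)
      exact mem_biUnion (mem_image_of_mem U ha) ⟨ha, rfl⟩
    obtain ⟨x, hx⟩ := hne a ha
    refine ⟨x, fun h => hfiber (h.mono ?_)⟩
    rintro b ⟨hb, hbV⟩
    exact ⟨hb, hbV ▸ hx⟩
  · obtain ⟨𝒱, h𝒱, hunc, x, hx⟩ :=
      hcal (U '' S) (forall_mem_image.2 fun a ha => ⟨hU a ha, hne a ha⟩) hUS
    refine ⟨x, fun h => hunc ((h.image U).mono fun V hV => ?_)⟩
    obtain ⟨a, ha, rfl⟩ := h𝒱 hV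
    exact ⟨a, ⟨ha, hx _ hV⟩, rfl⟩

theorem HasCaliberOmegaOne.exists_not_countable_pi (hcal : HasCaliberOmegaOne X) {ι : Type*}
    [Finite ι] [DecidableEq ι] {I : Type*} [Uncountable I] {U : I → Set (ι → X)}
    (hU : ∀ a x i, IsOpen {y | update x i y ∈ U a}) (hne : ∀ a, (U a).Nonempty) :
    ∃ z, ¬ {a | z ∈ U a}.Countable := by
  cases nonempty_fintype ι
  choose t ht using hne
  suffices ∀ s : Finset ι, ∃ z : ι → X, ¬ {a | s.piecewise z (t a) ∈ U a}.Countable by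
    simpa using this Finset.univ
  intro s
  induction s using Finset.induction_on with
  | empty =>
    obtain ⟨a⟩ : Nonempty I := inferInstance
    exact ⟨t a, by simpa [ht] using not_countable_univ⟩
  | insert i s hi ih =>
    obtain ⟨z, hz⟩ := ih
    obtain ⟨x, hx⟩ := hcal.exists_not_countable hz
      (U := fun a => {y | update (s.piecewise z (t a)) i y ∈ U a}) (fun a _ => hU a _ i)
      fun a ha => ⟨s.piecewise z (t a) i, by simpa using ha⟩
    refine ⟨update z i x, fun h => hx (h.mono fun a ha => ?_)⟩
    have hzx : s.piecewise (update z i x) (t a) = s.piecewise z (t a) :=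
      s.piecewise_congr (fun j hj => update_of_ne (ne_of_mem_of_not_mem hj hi) _ _) fun _ _ => rfl
    rw [mem_ofPred_eq, Finset.piecewise_insert, hzx, update_self]
    exact ha.2

end Caliber

/-- The well-ordered set of countable ordinals, used as an index set of transfinite chains. -/
abbrev OmegaOne : Type := (ℵ₁ : Cardinal.{0}).ord.ToType

namespace OmegaOne

instance : Uncountable OmegaOne := by
  rw [← Cardinal.aleph0_lt_mk_iff, Cardinal.mk_ord_toType]
  exact Cardinal.aleph0_lt_aleph_one

instance : NoMaxOrder OmegaOne :=
  Cardinal.noMaxOrder Cardinal.aleph0_lt_aleph_one.le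

theorem countable_Iio (a : OmegaOne) : (Iio a).Countable := by
  rw [← Cardinal.le_aleph0_iff_set_countable, ← Cardinal.lt_aleph_one_iff]
  simpa using Cardinal.mk_Iio_lt a (by simp)

theorem countable_setOf_ne_of_tendsto {W : Type*} [TopologicalSpace W] [T1Space W]
    [FirstCountableTopology W] {f : OmegaOne → W} {x : W} (hf : Tendsto f atTop (𝓝 x)) :
    {a | f a ≠ x}.Countable := by
  obtain ⟨s, hs⟩ := (𝓝 x).exists_antitone_basis
  choose b hb using fun n => eventually_atTop.1 (hf.eventually (hs.mem n))
  refine (countable_iUnion fun n => countable_Iio (b n)).mono fun a ha => ?_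
  obtain ⟨n, -, hn⟩ := hs.1.mem_iff.1 (isOpen_compl_singleton.mem_nhds (Ne.symm ha))
  exact mem_iUnion.2 ⟨n, not_le.1 fun hba => hn (hb n a hba) rfl⟩

theorem exists_chain {X : Type*} {R : Set X → Set X → Prop}
    (hmono : ∀ {A B B'}, R A B → B ⊆ B' → R A B')
    (hR : ∀ A : Set X, A.Countable → ∃ B : Set X, B.Countable ∧ R A B) :
    ∃ C : OmegaOne → Set X, ∀ a b, a < b → R (C a) (C b) := by
  choose! Φ hΦc hΦ using hR
  have hwf : WellFounded ((· < ·) : OmegaOne → OmegaOne → Prop) := wellFounded_lt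
  let C : OmegaOne → Set X := hwf.fix fun a C => ⋃ b : Iio a, Φ (C b b.2)
  have hC : ∀ a, C a = ⋃ b : Iio a, Φ (C b) := hwf.fix_eq _
  have hCc : ∀ a, (C a).Countable := fun a => by
    induction a using hwf.induction with
    | _ a ih =>
      have := (countable_Iio a).to_subtype
      exact hC a ▸ countable_iUnion fun b => hΦc _ (ih b b.2)
  refine ⟨C, fun a b hab => hmono (hΦ _ (hCc a)) ?_⟩
  rw [hC b]
  exact subset_iUnion_of_subset ⟨a, hab⟩ Subset.rfl

end OmegaOne

theorem metrizableSpace_pi_of_countable {J Z : Type*} [Countable J] [TopologicalSpace Z]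
    [MetrizableSpace Z] : MetrizableSpace (J → Z) :=
  letI := metrizableSpaceMetric Z
  inferInstance

section Reflection

variable {ι : Type*} [DecidableEq ι] {X : Type v} [TopologicalSpace X] {Z : Type w}

/-- `B` reflects `G` over `A`: the parameters of `G` in `A` give functions determined by `B`, and
every point of `X` is indistinguishable from a point of the closure of `B` by means of values of `G`
at tuples from `A`. A countable set that reflects `G` over itself plays the role of (the trace on
`X` of) a countable elementary submodel. -/
structure Reflects (G : X → (ι → X) → Z) (A B : Set X) : Prop where
  subset : A ⊆ B
  determines : ∀ d ∈ A, Determines (G d) B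
  exists_mem_closure : ∀ x, ∃ r ∈ closure B, ∀ d ∈ A, ∀ i,
    EqOn (fun c => G d (update c i r)) (fun c => G d (update c i x)) (univ.pi fun _ => A)

theorem Reflects.mono_right {G : X → (ι → X) → Z} {A B B' : Set X} (h : Reflects G A B)
    (hB : B ⊆ B') : Reflects G A B' where
  subset := h.subset.trans hB
  determines d hd := (h.determines d hd).mono hB
  exists_mem_closure x :=
    let ⟨r, hr, hrx⟩ := h.exists_mem_closure x
    ⟨r, closure_mono hB hr, hrx⟩

theorem Reflects.monotone {G : X → (ι → X) → Z} {I : Type*} [PartialOrder I] {C : I → Set X}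
    (h : ∀ a b, a < b → Reflects G (C a) (C b)) : Monotone C := fun a b hab =>
  hab.eq_or_lt.elim (fun hab => hab ▸ Subset.rfl) fun hab => (h a b hab).subset

variable [TopologicalSpace Z]

theorem Reflects.eq_of_eqOn [Finite ι] [T2Space Z] {G : X → (ι → X) → Z} {D : Set X}
    (h : Reflects G D D) (hG : ∀ d, ContinuousInEach (G d))
    (hG' : ∀ c, Continuous fun d => G d c) {x y : X} (hx : x ∈ closure D) (hy : y ∈ closure D)
    (hxy : EqOn (G x) (G y) (univ.pi fun _ => D)) : G x = G y := by
  choose r hr hrD using h.exists_mem_closure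
  have hretract : ∀ t, ∀ d ∈ closure D, G d (r ∘ t) = G d t := fun t d hd => by
    refine closure_minimal (fun d hd => ?_) (isClosed_eq (hG' (r ∘ t)) (hG' t)) hd
    exact eq_of_forall_update_eq fun i => h.determines d hd i _ _ (hrD (t i) d hd i)
  funext t
  rw [← hretract t x hx, ← hretract t y hy]
  exact (hG x).eqOn_pi_closure (hG y) hxy fun i _ => hr (t i)

variable [CompactSpace X]

theorem exists_countable_image_closure_eq_range [MetrizableSpace Z] {Q : X → Z}
    (hQ : Continuous Q) : ∃ C : Set X, C.Countable ∧ Q '' closure C = range Q := by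
  obtain ⟨T, hT, hTc, hd⟩ := (isCompact_range hQ).isSeparable.exists_countable_dense_subset
  obtain ⟨C, rfl, hinj⟩ := exists_image_eq_injOn_of_subset_range hT
  refine ⟨C, countable_of_injective_of_countable_image hinj hTc,
    (image_subset_range _ _).antisymm (hd.trans ?_)⟩
  exact closure_minimal (image_mono subset_closure) (isClosed_closure.isCompact.image hQ).isClosed

theorem exists_countable_reflects [Finite ι] [MetrizableSpace Z] {G : X → (ι → X) → Z}
    (hG : ∀ d, ContinuousInEach (G d)) (hdet : ∀ d, ∃ C : Set X, C.Countable ∧ Determines (G d) C)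
    {A : Set X} (hA : A.Countable) : ∃ B : Set X, B.Countable ∧ Reflects G A B := by
  choose C hCc hC using hdet
  have := hA.to_subtype
  have := metrizableSpace_pi_of_countable (Z := Z) (J := A × (ι → A) × ι)
  obtain ⟨K, hKc, hK⟩ := exists_countable_image_closure_eq_range
    (Q := fun x (p : A × (ι → A) × ι) => G p.1 (update (fun j => (p.2.1 j : X)) p.2.2 x))
    (continuous_pi fun p => hG _ _ _)
  refine ⟨A ∪ (⋃ d ∈ A, C d) ∪ K, (hA.union (hA.biUnion fun d _ => hCc d)).union hKc, ?_, ?_, ?_⟩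
  · exact subset_union_left.trans subset_union_left
  · exact fun d hd => (hC d).mono fun x hx => .inl (.inr (mem_biUnion hd hx))
  · intro x
    obtain ⟨r, hr, hrx⟩ := hK.ge (mem_range_self x)
    exact ⟨r, closure_mono subset_union_right hr, fun d hd i c hc =>
      congr_fun hrx (⟨d, hd⟩, fun j => ⟨c j, hc j (mem_univ j)⟩, i)⟩

theorem Reflects.iUnion [Finite ι] [T2Space Z] {G : X → (ι → X) → Z}
    (hG : ∀ d, ContinuousInEach (G d)) {I : Type*} [LinearOrder I] [NoMaxOrder I] [Nonempty I]
    {C : I → Set X} (h : ∀ a b, a < b → Reflects G (C a) (C b)) :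
    Reflects G (⋃ a, C a) (⋃ a, C a) where
  subset := Subset.rfl
  determines d hd := by
    obtain ⟨a, ha⟩ := mem_iUnion.1 hd
    obtain ⟨b, hab⟩ := exists_gt a
    exact ((h a b hab).determines d ha).mono (subset_iUnion C b)
  exists_mem_closure x := by
    have hC := Reflects.monotone h
    let K : I → Set X := fun a => closure (⋃ a, C a) ∩ {r | ∀ d ∈ C a, ∀ i,
      ∀ c ∈ univ.pi fun _ => C a, G d (update c i r) = G d (update c i x)}
    have hK : Antitone K := fun a b hab r hr =>
      ⟨hr.1, fun d hd i c hc => hr.2 d (hC hab hd) i c (pi_mono (fun _ _ => hC hab) hc)⟩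
    have hKclosed : ∀ a, IsClosed (K a) := fun a => by
      refine isClosed_closure.inter ?_
      simp only [ofPred_forall]
      exact isClosed_biInter fun d _ => isClosed_iInter fun i => isClosed_biInter fun c _ =>
        isClosed_eq (hG d c i) continuous_const
    have hKne : ∀ a, (K a).Nonempty := fun a => by
      obtain ⟨b, hab⟩ := exists_gt a
      obtain ⟨r, hr, hrx⟩ := (h a b hab).exists_mem_closure x
      exact ⟨r, closure_mono (subset_iUnion C b) hr, hrx⟩
    obtain ⟨r, hr⟩ := IsCompact.nonempty_iInter_of_directed_nonempty_isCompact_isClosed K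
      hK.directed_ge hKne (fun a => (hKclosed a).isCompact) hKclosed
    rw [mem_iInter] at hr
    refine ⟨r, (hr (Classical.arbitrary I)).1, fun d hd i c hc => ?_⟩
    obtain ⟨a, ha⟩ := mem_iUnion.1 hd
    rw [← iUnion_univ_pi_of_monotone fun _ => hC] at hc
    obtain ⟨b, hb⟩ := mem_iUnion.1 hc
    exact (hr (max a b)).2 d (hC (le_max_left a b) ha) i c
      (pi_mono (fun _ _ => hC (le_max_right a b)) hb)

theorem Reflects.tendsto_dist_atTop [Finite ι] {M : Type*} [MetricSpace M] {G : X → (ι → X) → M}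
    (hG : ∀ d, ContinuousInEach (G d)) (hG' : ∀ c, Continuous fun d => G d c) {I : Type*}
    [LinearOrder I] [NoMaxOrder I] [Nonempty I] {C : I → Set X}
    (h : ∀ a b, a < b → Reflects G (C a) (C b)) {v w : I → X} (hv : ∀ a, v a ∈ ⋃ a, C a)
    (hw : ∀ a, w a ∈ ⋃ a, C a) (hvw : ∀ a, EqOn (G (v a)) (G (w a)) (univ.pi fun _ => C a))
    (z : ι → X) : Tendsto (fun a => dist (G (v a) z) (G (w a) z)) atTop (𝓝 0) := by
  rw [tendsto_iff_ultrafilter]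
  intro 𝒰 h𝒰
  have hlim : ∀ u : I → X, Tendsto u 𝒰 (𝓝 (𝒰.map u).lim) := fun u => (𝒰.map u).le_nhds_lim
  have hmem : ∀ u : I → X, (∀ a, u a ∈ ⋃ a, C a) → (𝒰.map u).lim ∈ closure (⋃ a, C a) :=
    fun u hu => mem_closure_of_tendsto (hlim u) (Eventually.of_forall hu)
  have hGlim : ∀ u : I → X, ∀ c, Tendsto (fun a => G (u a) c) 𝒰 (𝓝 (G (𝒰.map u).lim c)) :=
    fun u c => ((hG' c).tendsto _).comp (hlim u)
  have hagree : EqOn (G (𝒰.map v).lim) (G (𝒰.map w).lim) (univ.pi fun _ => ⋃ a, C a) := by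
    have hC := Reflects.monotone h
    intro c hc
    rw [← iUnion_univ_pi_of_monotone fun _ => hC] at hc
    obtain ⟨b, hb⟩ := mem_iUnion.1 hc
    refine tendsto_nhds_unique_of_eventuallyEq (hGlim v c) (hGlim w c) (h𝒰 ?_)
    filter_upwards [eventually_ge_atTop b] with a hba
    exact hvw a (pi_mono (fun _ _ => hC hba) hb)
  have heq := (Reflects.iUnion hG h).eq_of_eqOn hG hG' (hmem v hv) (hmem w hw) hagree
  have hdist := (hGlim v z).dist (hGlim w z)
  rwa [heq, dist_self] at hdist

/-- Otherwise a chain of length `ω₁` of countable sets, each reflecting `G` over its predecessors,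
contains `ω₁` pairs that violate the conclusion. Caliber `ω₁` makes uncountably many of these
violations happen at one point `z`, whereas at `z` only countably many do. -/
theorem HasCaliberOmegaOne.exists_countable_forall_eq_of_eqOn [Finite ι] [MetrizableSpace Z]
    (hcal : HasCaliberOmegaOne X) {G : X → (ι → X) → Z} (hG : ∀ d, ContinuousInEach (G d))
    (hG' : ∀ c, Continuous fun d => G d c)
    (hdet : ∀ d, ∃ C : Set X, C.Countable ∧ Determines (G d) C) :
    ∃ C : Set X, C.Countable ∧ ∀ x y, EqOn (G x) (G y) (univ.pi fun _ => C) → G x = G y := by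
  let := metrizableSpaceMetric Z
  by_contra! hcon
  obtain ⟨C, hC⟩ := OmegaOne.exists_chain
    (R := fun A B => Reflects G A B ∧
      ∃ x ∈ B, ∃ y ∈ B, EqOn (G x) (G y) (univ.pi fun _ => A) ∧ G x ≠ G y)
    (fun ⟨hAB, x, hx, y, hy, hxy⟩ hB => ⟨hAB.mono_right hB, x, hB hx, y, hB hy, hxy⟩)
    fun A hA => by
      obtain ⟨B, hBc, hB⟩ := exists_countable_reflects hG hdet hA
      obtain ⟨x, y, hxy⟩ := hcon A hA
      exact ⟨insert x (insert y B), (hBc.insert y).insert x,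
        hB.mono_right ((subset_insert _ _).trans (subset_insert _ _)),
        x, mem_insert _ _, y, mem_insert_of_mem _ (mem_insert _ _), hxy⟩
  choose b hb using fun a : OmegaOne => exists_gt a
  choose hrefl v hv w hw hvw hne using hC
  obtain ⟨z, hz⟩ := hcal.exists_not_countable_pi
    (U := fun a => {c | G (v a (b a) (hb a)) c ≠ G (w a (b a) (hb a)) c})
    (fun a c i => isOpen_ne_fun (hG _ c i) (hG _ c i)) fun a => ne_iff.1 (hne a (b a) (hb a))
  refine hz ?_
  have hlim := Reflects.tendsto_dist_atTop hG hG' hrefl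
    (fun a => mem_iUnion_of_mem _ (hv a (b a) (hb a)))
    (fun a => mem_iUnion_of_mem _ (hw a (b a) (hb a))) (fun a => hvw a (b a) (hb a)) z
  simpa only [ne_eq, dist_eq_zero, mem_ofPred_eq] using
    OmegaOne.countable_setOf_ne_of_tendsto hlim

end Reflection

section CountablyManyFunctions

variable {X : Type v} [TopologicalSpace X] [CompactSpace X] {Z : Type w} [TopologicalSpace Z]
  [MetrizableSpace Z]

theorem ContinuousInEach.exists_countable_determines (hcal : HasCaliberOmegaOne X) {n : ℕ}
    {F : (Fin n → X) → Z} (hF : ContinuousInEach F) :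
    ∃ C : Set X, C.Countable ∧ Determines F C := by
  induction n with
  | zero => exact ⟨∅, countable_empty, fun i => i.elim0⟩
  | succ n ih =>
    rcases isEmpty_or_nonempty X with hX | ⟨⟨x₀⟩⟩
    · exact ⟨∅, countable_empty, fun _ x => hX.elim x⟩
    have hcoord : ∀ i : Fin (n + 1), ∃ C : Set X, C.Countable ∧ ∀ x y,
        EqOn (fun c => F (i.insertNth x c)) (fun c => F (i.insertNth y c)) (univ.pi fun _ => C) →
          (fun c => F (i.insertNth x c)) = fun c => F (i.insertNth y c) := by
      intro i
      have hsection : ∀ d, ContinuousInEach fun c : Fin n → X => F (i.insertNth d c) := by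
        intro d c j
        simpa only [Fin.insertNth_update] using hF (i.insertNth d c) (i.succAbove j)
      refine hcal.exists_countable_forall_eq_of_eqOn hsection (fun c => ?_) fun d => ih (hsection d)
      simpa only [Fin.update_insertNth] using hF (i.insertNth x₀ c) i
    choose C hCc hC using hcoord
    refine ⟨insert x₀ (⋃ i, C i), (countable_iUnion hCc).insert _, fun i x y hxy c => ?_⟩
    have hsections : (fun c => F (i.insertNth x c)) = fun c => F (i.insertNth y c) := by
      refine hC i x y fun c hc => ?_
      have hmem : i.insertNth x₀ c ∈ univ.pi fun _ => insert x₀ (⋃ i, C i) := fun j _ => by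
        refine Fin.succAboveCases i ?_ (fun k => ?_) j
        · simp
        · simpa using Or.inr ⟨i, hc k (mem_univ k)⟩
      simpa only [Fin.update_insertNth] using hxy hmem
    simpa only [Fin.insertNth_removeNth] using congr_fun hsections (i.removeNth c)

theorem ContinuousInEach.exists_countable_forall_eq (hcal : HasCaliberOmegaOne X) {n : ℕ}
    {F : (Fin n → X) → Z} (hF : ContinuousInEach F) :
    ∃ 𝓠 : Set C(X, Z), 𝓠.Countable ∧
      ∀ x y : Fin n → X, (∀ q ∈ 𝓠, ∀ i, q (x i) = q (y i)) → F x = F y := by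
  obtain ⟨C, hCc, hC⟩ := hF.exists_countable_determines hcal
  have := hCc.to_subtype
  refine ⟨range fun p : (Fin n → C) × Fin n => hF.slice (fun j => p.1 j) p.2, countable_range _,
    fun x y hxy => eq_of_forall_update_eq fun i => hC i _ _ fun c hc => ?_⟩
  exact hxy _ ⟨(fun j => ⟨c j, hc j (mem_univ j)⟩, i), rfl⟩ i

end CountablyManyFunctions

theorem exists_countable_superset_closed_under {α : Type*} {Φ : α → Set α}
    (hΦ : ∀ a, (Φ a).Countable) {S : Set α} (hS : S.Countable) :
    ∃ T, T.Countable ∧ S ⊆ T ∧ ∀ a ∈ T, Φ a ⊆ T := by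
  let step : Set α → Set α := fun A => ⋃ a ∈ A, Φ a
  refine ⟨⋃ k, step^[k] S, countable_iUnion fun k => ?_, subset_iUnion_of_subset 0 Subset.rfl,
    fun a ha => ?_⟩
  · induction k with
    | zero => exact hS
    | succ k ih =>
      rw [iterate_succ_apply']
      exact ih.biUnion fun a _ => hΦ a
  · obtain ⟨k, hk⟩ := mem_iUnion.1 ha
    refine subset_iUnion_of_subset (k + 1) ?_
    rw [iterate_succ_apply']
    exact subset_biUnion_of_mem hk

section QuotientAlgebra

variable {E : Type u} [TopologicalSpace E] [ContinuousSignature E] {X : Type v} [SigAlgebra E X]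

/-- The operations of `X` on representatives. They do not depend on the choice of representatives
only if `s` is a congruence. -/
noncomputable instance (s : Setoid X) : SigAlgebra E (Quotient s) where
  op n t y := ⟦SigAlgebra.op n t fun i => (y i).out⟧

variable (E) in
/-- A congruence of an `E`-algebra: an equivalence relation compatible with all operations. -/
def IsCongruence (s : Setoid X) : Prop :=
  ∀ (n : ℕ) (t : ContinuousSignature.Symbols E n) (x y : Fin n → X),
    (∀ i, s (x i) (y i)) → s (SigAlgebra.op n t x) (SigAlgebra.op n t y)

theorem IsCongruence.isAlgebraHom_mk {s : Setoid X} (hs : IsCongruence E s) :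
    IsAlgebraHom E (Quotient.mk s) := fun n t _ =>
  Quotient.sound (hs n t _ _ fun _ => s.symm (Quotient.mk_out _))

variable [TopologicalSpace X]

theorem IsCongruence.isSemitopologicalAlgebra_quotient {s : Setoid X} (hs : IsCongruence E s)
    (hX : IsSemitopologicalAlgebra E X) : IsSemitopologicalAlgebra E (Quotient s) := by
  refine fun n => ⟨fun y => continuous_quotient_mk'.comp ((hX n).1 _), fun t y i => ?_⟩
  rw [isQuotientMap_quotient_mk'.continuous_iff]
  refine (continuous_quotient_mk'.comp ((hX n).2 t (fun k => (y k).out) i)).congr fun x => ?_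
  have hlift : (fun k => (⟦update (fun k => (y k).out) i x k⟧ : Quotient s)) = update y i ⟦x⟧ := by
    ext k
    rcases eq_or_ne k i with rfl | hk
    · simp
    · simp [hk]
  exact (hs.isAlgebraHom_mk n t _).trans (congr_arg _ hlift)

theorem metrizableSpace_quotient_ker [CompactSpace X] {W : Type*} [TopologicalSpace W]
    [MetrizableSpace W] {Q : X → W} (hQ : Continuous Q) :
    MetrizableSpace (Quotient (Setoid.ker Q)) := by
  have hlift : Continuous (Setoid.kerLift Q) := hQ.quotient_lift _
  exact (hlift.isClosedEmbedding (Setoid.kerLift_injective Q)).isEmbedding.metrizableSpace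

end QuotientAlgebra

section Factorization

variable {E : Type u} [TopologicalSpace E] [ContinuousSignature E] [SeparableSpace E]
  {X : Type v} [TopologicalSpace X] [CompactSpace X] [SigAlgebra E X]
  {Z : Type w} [TopologicalSpace Z] [MetrizableSpace Z]

theorem exists_countable_isCongruence_ker (hX : IsSemitopologicalAlgebra E X)
    (hcal : HasCaliberOmegaOne X) (f : C(X, Z)) :
    ∃ 𝓠 : Set C(X, Z), 𝓠.Countable ∧ f ∈ 𝓠 ∧
      IsCongruence E (Setoid.ker fun (x : X) (q : 𝓠) => q.1 x) := by
  have hsep (n : ℕ) : SeparableSpace (ContinuousSignature.Symbols E n) :=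
    (ContinuousSignature.isClopen_fiber n).isOpen.isOpenEmbedding_subtypeVal.separableSpace
  choose D hDc hD using fun n => exists_countable_dense (ContinuousSignature.Symbols E n)
  have hop (q : C(X, Z)) (n : ℕ) (t : ContinuousSignature.Symbols E n) :
      ContinuousInEach fun x => q (SigAlgebra.op n t x) :=
    fun x i => q.continuous.comp ((hX n).2 t x i)
  choose Φ hΦc hΦ using fun q n t => (hop q n t).exists_countable_forall_eq hcal
  obtain ⟨𝓠, h𝓠c, hf, h𝓠⟩ := exists_countable_superset_closed_under
    (Φ := fun q => ⋃ n, ⋃ t ∈ D n, Φ q n t)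
    (fun q => countable_iUnion fun n => (hDc n).biUnion fun t _ => hΦc q n t)
    (countable_singleton f)
  refine ⟨𝓠, h𝓠c, singleton_subset_iff.1 hf, fun n t x y hxy => funext fun ⟨q, hq⟩ => ?_⟩
  have hdense : ∀ t ∈ D n, q (SigAlgebra.op n t x) = q (SigAlgebra.op n t y) := fun t ht =>
    hΦ q n t x y fun p hp i => congr_fun (hxy i)
      ⟨p, h𝓠 q hq (mem_iUnion_of_mem n (mem_biUnion ht hp))⟩
  have hcont (x : Fin n → X) : Continuous fun t : ContinuousSignature.Symbols E n =>
      q (SigAlgebra.op n t x) := q.continuous.comp ((hX n).1 x)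
  exact congr_fun ((hcont x).ext_on (hD n) (hcont y) hdense) t

theorem theoremt_general (hX : IsSemitopologicalAlgebra E X) (hcal : HasCaliberOmegaOne X)
    {f : X → Z} (hf : Continuous f) :
    ∃ (Y : Type v) (_ : TopologicalSpace Y) (_ : SigAlgebra E Y) (g : Y → Z) (h : X → Y),
      SeparableSpace Y ∧ MetrizableSpace Y ∧ IsSemitopologicalAlgebra E Y ∧ Continuous g ∧
      Continuous h ∧ IsAlgebraHom E h ∧ f = g ∘ h := by
  obtain ⟨𝓠, h𝓠c, hf𝓠, hcongr⟩ := exists_countable_isCongruence_ker hX hcal ⟨f, hf⟩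
  have := h𝓠c.to_subtype
  have := metrizableSpace_pi_of_countable (Z := Z) (J := 𝓠)
  let Q : X → 𝓠 → Z := fun x q => q.1 x
  have hmetr := metrizableSpace_quotient_ker (Q := Q) (by fun_prop)
  have hsep : SeparableSpace (Quotient (Setoid.ker Q)) := by
    let := metrizableSpaceMetric (Quotient (Setoid.ker Q))
    infer_instance
  have hfQ : ∀ x y, Setoid.ker Q x y → f x = f y := fun x y hxy => congr_fun hxy ⟨_, hf𝓠⟩
  exact ⟨Quotient (Setoid.ker Q), inferInstance, inferInstance, Quotient.lift f hfQ,
    Quotient.mk _, hsep, hmetr, hcongr.isSemitopologicalAlgebra_quotient hX,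
    hf.quotient_lift hfQ, continuous_quotient_mk', hcongr.isAlgebraHom_mk, rfl⟩

end Factorization

theorem theoremt {E : Type u} [TopologicalSpace E] [ContinuousSignature E]
    [TopologicalSpace.SeparableSpace E]
    {X : Type v} [TopologicalSpace X] [CompactSpace X] [T2Space X] [SigAlgebra E X]
    (hX : IsSemitopologicalAlgebra E X) (hcal : HasCaliberOmegaOne X) :
    IsRFactorizable E X :=
  fun _ hf => theoremt_general hX hcal hf
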